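/- For a finite abelian group $A$ (written multiplicatively) put $A_2=\{a\in A: a^2=1\}$, and for an inverse-closed subset $S\subseteq A\setminus\{1\}$ let $\mathrm{Cay}(A,S)$ be the graph with vertex set $A$ in which $g,h$ are adjacent if and only if $gh^{-1}\in S$. For a subgroup $B$ of $A$ of index $2$, a bipartite Cayley graph on $A$ with bipartition $\{B,A\setminus B\}$ is a graph $\mathrm{Cay}(A,S)$, with $S$ inverse-closed, every edge of which joins an element of $B$ to an element of $A\setminus B$ (equivalently, $S\subseteq A\setminus B$). Let $N(A,B)$ be the number of these graphs, counted up to graph isomorphism. Write $C_t$ for the cyclic group of order $t$, and call $(A,B)$ exceptional if either $A\cong C_4\times C_2^{\ell}$ and $B\cong C_2^{\ell+1}$ for some $\ell\ge 1$, or $A\cong C_4^2\times C_2^{\ell}$ and $B\cong C_4\times C_2^{\ell+1}$ for some $\ell\ge 0$. **Theorem.** If $A$ is a finite abelian group, $B$ is a subgroup of $A$ of index $2$ and $(A,B)$ is not exceptional, then $$N(A,B)=2^{\frac{|A|}{4}+\frac{|A_2\setminus B|}{2}+o(|A|)},$$ where $o(|A|)$ is uniform in the pair $(A,B)$: for every real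 $\varepsilon>0$ there is $n_0$, depending only on $\varepsilon$, such that $$2^{\frac{|A|}{4}+\frac{|A_2\setminus B|}{2}-\varepsilon|A|}\le N(A,B)\le 2^{\frac{|A|}{4}+\frac{|A_2\setminus B|}{2}+\varepsilon|A|}$$ for all such pairs with $|A|\ge n_0$. -/

import Mathlib

/-- Two graphs on the vertex set `V` are equivalent when they are isomorphic as graphs
(via any bijection of `V`, with no condition on bipartitions or group structure). -/
def graphIsoSetoid (V : Type*) : Setoid (SimpleGraph V) where
  r Γ Δ := Nonempty (Γ ≃g Δ)
  iseqv :=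
    { refl := fun _ => ⟨RelIso.refl _⟩
      symm := fun ⟨e⟩ => ⟨e.symm⟩
      trans := fun ⟨e⟩ ⟨f⟩ => ⟨e.trans f⟩ }

/-- The (labelled) bipartite Cayley graphs on `A` with bipartition `{B, A \ B}`: the graphs
`Cay(A, S)`, for an inverse-closed `S ⊆ A` without the identity, all of whose edges join `B`
to its complement. -/
def bipartiteCayleyGraphs {A : Type*} [CommGroup A] (B : Subgroup A) : Set (SimpleGraph A) :=
  {Γ | (∃ S : Set A, S⁻¹ = S ∧ (1 : A) ∉ S ∧ Γ = SimpleGraph.mulCayley S) ∧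
    Γ.IsBipartiteWith (B : Set A) (B : Set A)ᶜ}

/-- In an abelian group and for an inverse-closed `S` without the identity, Mathlib's Cayley graph
has the adjacency relation `g h⁻¹ ∈ S`. -/
theorem mulCayley_adj_iff_of_inv_eq {A : Type*} [CommGroup A] {S : Set A} (hS : S⁻¹ = S)
    (h1 : (1 : A) ∉ S) (g h : A) : (SimpleGraph.mulCayley S).Adj g h ↔ g * h⁻¹ ∈ S := by
  have inv : ∀ x ∈ S, x⁻¹ ∈ S := fun x hx => by
    rw [← hS]; simpa using hx
  rw [SimpleGraph.mulCayley_adj']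
  constructor
  · rintro ⟨-, s, hs, rfl | rfl⟩
    · simpa [mul_comm] using inv s hs
    · simpa [mul_comm] using hs
  · intro hs
    refine ⟨?_, g * h⁻¹, hs, Or.inr ?_⟩
    · rintro rfl
      exact h1 (by simpa using hs)
    · rw [mul_comm g, mul_inv_cancel_left]

/-- When `B` has index two, these graphs are the `Cay(A, S)` with `S` an inverse-closed subset
of `A \ B`. -/
theorem mem_bipartiteCayleyGraphs_iff {A : Type*} [CommGroup A] {B : Subgroup A}
    (hB : B.index = 2) (Γ : SimpleGraph A) :
    Γ ∈ bipartiteCayleyGraphs B ↔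
      ∃ S : Set A, S⁻¹ = S ∧ S ⊆ (B : Set A)ᶜ ∧ Γ = SimpleGraph.mulCayley S := by
  constructor
  · rintro ⟨⟨S, hS, h1, rfl⟩, -, hb⟩
    refine ⟨S, hS, fun s hs hsB => ?_, rfl⟩
    have := hb ((mulCayley_adj_iff_of_inv_eq hS h1 s 1).2 (by simpa using hs))
    simp_all [B.one_mem]
  · rintro ⟨S, hS, hSB, rfl⟩
    have h1 : (1 : A) ∉ S := fun h => hSB h B.one_mem
    refine ⟨⟨S, hS, h1, rfl⟩, disjoint_compl_right, fun g h hgh => ?_⟩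
    rw [mulCayley_adj_iff_of_inv_eq hS h1] at hgh
    have hn : g * h⁻¹ ∉ B := hSB hgh
    rw [Subgroup.mul_mem_iff_of_index_two hB, inv_mem_iff] at hn
    simp only [SetLike.mem_coe, Set.mem_compl_iff]
    tauto

/-- The number of bipartite Cayley graphs on `A` with bipartition `{B, A \ B}`, up to graph
isomorphism. -/
noncomputable def numUnlabelledBipartiteCayleyGraphs {A : Type*} [CommGroup A]
    (B : Subgroup A) : ℕ :=
  (Quotient.mk (graphIsoSetoid A) '' bipartiteCayleyGraphs B).ncard

/-- `A ≅ C₄ × C₂^ℓ` with `ℓ ≥ 1` and `B ≅ C₂^(ℓ+1)`, or `A ≅ C₄² × C₂^ℓ` with `ℓ ≥ 0` and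
`B ≅ C₄ × C₂^(ℓ+1)`. -/
def IsExceptionalPair {A : Type*} [CommGroup A] (B : Subgroup A) : Prop :=
  (∃ l : ℕ, 1 ≤ l ∧
    Nonempty (A ≃* Multiplicative (ZMod 4 × (Fin l → ZMod 2))) ∧
    Nonempty (B ≃* Multiplicative (Fin (l + 1) → ZMod 2))) ∨
  (∃ l : ℕ,
    Nonempty (A ≃* Multiplicative ((ZMod 4 × ZMod 4) × (Fin l → ZMod 2))) ∧
    Nonempty (B ≃* Multiplicative (ZMod 4 × (Fin (l + 1) → ZMod 2))))

/-! Write n = |A|. A connection set is a free choice on each of the k inverse pairs {u, u⁻¹} in A \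
B, so there are 2^k labelled graphs with 4k = n + 2|A₂ \ B|. This is the upper bound. For the lower
bound it suffices that at least half of these sets lie in isomorphism classes of size 2^o(n).

Call S good if |S ∆ dS| > 2√n for every d ≠ 1 in B. For fixed d, knowing S ∆ dS links the choices on
different inverse pairs and saves about n/16 bits, unless inversion cancels translation by d on most
of A \ B, that is, v² = d⁻¹ for most v. That would force B to have exponent two and the pair to be
exceptional (`four_mul_ncard_sq_eq_le`). So bad sets are rare (`ncard_almost_invariant_le`).

If S is good, any two vertices have neighbourhoods differing in many points, so some O(√n log n)
vertices separate all vertices (`exists_determining_tuple`), and the automorphism group has order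
2^O(√n log² n). A class is no larger than n·|Aut|^r, with r ≤ log₂ n the size of a generating tuple
(`ncard_connectionSets_iso_le`). The total loss is 2^O(√n log³ n). -/

open scoped Pointwise

/-! ### Elementary estimates: hitting tuples, small sets, generating tuples. -/

/-- A tuple of `t` points meets every member of a family of large sets, by averaging over tuples. -/
theorem exists_tuple_hitting {α ι : Type*} [Fintype α] [Fintype ι] [DecidableEq α]
    (U : ι → Finset α) (m t : ℕ) (hU : ∀ i, m ≤ (U i).card)
    (h : Fintype.card ι * (Fintype.card α - m) ^ t < Fintype.card α ^ t) :
    ∃ f : Fin t → α, ∀ i, ∃ j, f j ∈ U i := by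
  by_contra! hcon
  have hsub : (Finset.univ : Finset (Fin t → α)) ⊆
      Finset.univ.biUnion fun i => Fintype.piFinset fun _ => (U i)ᶜ := by
    intro f _
    obtain ⟨i, hi⟩ := hcon f
    simp only [Finset.mem_biUnion, Finset.mem_univ, true_and, Fintype.mem_piFinset,
      Finset.mem_compl]
    exact ⟨i, hi⟩
  have hcard := (Finset.card_le_card hsub).trans Finset.card_biUnion_le
  have hsum : ∑ i, (Fintype.piFinset fun _ : Fin t => (U i)ᶜ).card ≤
      ∑ _i : ι, (Fintype.card α - m) ^ t := by
    refine Finset.sum_le_sum fun i _ => ?_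
    rw [Fintype.card_piFinset]
    simp only [Finset.prod_const, Finset.card_univ, Fintype.card_fin, Finset.card_compl]
    have := hU i
    gcongr
  simp at hcard hsum
  omega

/-- Bernoulli's inequality (1 + m/a)^p ≥ 1 + pm/a with denominators cleared. -/
theorem pow_mul_add_le_mul_add_pow (a m p : ℕ) : a ^ p * (a + p * m) ≤ a * (a + m) ^ p := by
  induction p with
  | zero => simp
  | succ p ih =>
    calc a ^ (p + 1) * (a + (p + 1) * m) ≤ a ^ p * (a + p * m) * (a + m) := by
          have : a * (a + (p + 1) * m) ≤ (a + p * m) * (a + m) := by nlinarith [Nat.zero_le (p * m * m)]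
          calc _ = a ^ p * (a * (a + (p + 1) * m)) := by ring
            _ ≤ a ^ p * ((a + p * m) * (a + m)) := by gcongr
            _ = _ := by ring
      _ ≤ a * (a + m) ^ p * (a + m) := by gcongr
      _ = _ := by ring

/-- By Bernoulli with a = n - m: here pm ≥ n ≥ a, so (n/a)^p ≥ 2. Thus p random points miss a set of
density m/n with probability at most 1/2. -/
theorem two_mul_sub_pow_le {n m p : ℕ} (hp : 0 < p) (hmn : m ≤ n) (h : n ≤ p * m) :
    2 * (n - m) ^ p ≤ n ^ p := by
  obtain ⟨a, rfl⟩ := Nat.exists_eq_add_of_le hmn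
  rw [Nat.add_sub_cancel_left, add_comm m a]
  rcases Nat.eq_zero_or_pos a with rfl | ha
  · simp [hp.ne']
  · refine Nat.le_of_mul_le_mul_left ?_ ha
    calc a * (2 * a ^ p) = a ^ p * (a + a) := by ring
      _ ≤ a ^ p * (a + p * m) := by gcongr; omega
      _ ≤ _ := pow_mul_add_le_mul_add_pow a m p

theorem mul_sub_pow_lt {n m p s N : ℕ} (hp : 0 < p) (hn : 0 < n) (hmn : m ≤ n) (h : n ≤ p * m)
    (hN : N < 2 ^ s) : N * (n - m) ^ (p * s) < n ^ (p * s) := by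
  have h1 : 2 ^ s * (n - m) ^ (p * s) ≤ n ^ (p * s) := by
    rw [pow_mul, pow_mul, ← mul_pow]
    exact Nat.pow_le_pow_left (two_mul_sub_pow_le hp hmn h) s
  rcases Nat.eq_zero_or_pos ((n - m) ^ (p * s)) with h0 | h0
  · rw [h0]; simp only [mul_zero]; positivity
  · exact (Nat.mul_lt_mul_of_pos_right hN h0).trans_le h1

/-- The number of sets with at most `m` elements. -/
theorem ncard_setOf_ncard_le {α : Type*} [Finite α] (m : ℕ) :
    {D : Set α | D.ncard ≤ m}.ncard ≤ (Nat.card α + 1) ^ m := by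
  classical
  have hsub : {D : Set α | D.ncard ≤ m} ⊆
      Set.range fun f : Fin m → Option α => {a | ∃ i, f i = some a} := by
    intro D hD
    have hD' : Nat.card D ≤ m := hD
    obtain ⟨e⟩ := Finite.equivFin D |> Nonempty.intro
    refine ⟨fun i => if h : i.1 < Nat.card D then some (e.symm ⟨i, h⟩ : α) else none, ?_⟩
    ext a
    constructor
    · rintro ⟨i, hi⟩
      dsimp only at hi
      split_ifs at hi with h
      simp only [Option.some.injEq] at hi
      rw [← hi]
      exact (e.symm ⟨i, h⟩).2
    · intro ha
      refine ⟨⟨(e ⟨a, ha⟩).1, (e ⟨a, ha⟩).2.trans_le hD'⟩, ?_⟩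
      dsimp only
      rw [dif_pos (e ⟨a, ha⟩).2, Fin.eta, Equiv.symm_apply_apply]
  calc _ ≤ (Set.range fun f : Fin m → Option α => {a | ∃ i, f i = some a}).ncard :=
        Set.ncard_le_ncard hsub (Set.toFinite _)
    _ ≤ Nat.card (Fin m → Option α) := by
        rw [← Set.image_univ, ← Set.ncard_univ]
        exact Set.ncard_image_le (Set.toFinite _)
    _ = _ := by
        simp [Nat.card_fun, Finite.card_option]

/-- By Lagrange, each generator taken outside the subgroup generated so far at least doubles that
subgroup. -/
theorem exists_generating_tuple (A : Type*) [Group A] [Finite A] :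
    ∃ (r : ℕ) (g : Fin r → A), 2 ^ r ≤ Nat.card A ∧ Subgroup.closure (Set.range g) = ⊤ := by
  have key : ∀ k : ℕ, ∃ (r : ℕ) (g : Fin r → A),
      2 ^ r ≤ Nat.card (Subgroup.closure (Set.range g)) ∧
        (Subgroup.closure (Set.range g) = ⊤ ∨ k ≤ r) := by
    intro k
    induction k with
    | zero => exact ⟨0, Fin.elim0, by simp, Or.inr le_rfl⟩
    | succ k ih =>
      obtain ⟨r, g, hg, htop | hk⟩ := ih
      · exact ⟨r, g, hg, Or.inl htop⟩
      by_cases htop : Subgroup.closure (Set.range g) = ⊤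
      · exact ⟨r, g, hg, Or.inl htop⟩
      obtain ⟨x, hx⟩ : ∃ x, x ∉ Subgroup.closure (Set.range g) := by
        by_contra! hall
        exact htop (Subgroup.eq_top_iff' _ |>.2 hall)
      refine ⟨r + 1, Fin.cons x g, ?_, Or.inr (by omega)⟩
      have hle : Subgroup.closure (Set.range g) ≤
          Subgroup.closure (Set.range (Fin.cons x g : Fin (r + 1) → A)) := by
        apply Subgroup.closure_mono
        rw [Fin.range_cons]
        exact Set.subset_insert _ _
      have hxm : x ∈ Subgroup.closure (Set.range (Fin.cons x g : Fin (r + 1) → A)) :=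
        Subgroup.subset_closure ⟨0, rfl⟩
      obtain ⟨c, hc⟩ := Subgroup.card_dvd_of_le hle
      have hpos : 0 < Nat.card (Subgroup.closure (Set.range (Fin.cons x g : Fin (r + 1) → A))) :=
        Nat.card_pos
      have hc2 : 2 ≤ c := by
        by_contra! hlt
        interval_cases c
        · omega
        · have := Subgroup.eq_of_le_of_card_ge hle (by omega)
          exact hx (this ▸ hxm)
      rw [hc, pow_succ]
      exact Nat.mul_le_mul hg hc2
  obtain ⟨r, g, hg, h⟩ := key (Nat.card A)
  have hle := hg.trans (Subgroup.card_le_card_group _)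
  refine ⟨r, g, hle, h.resolve_right fun hr => ?_⟩
  exact absurd (r.lt_two_pow_self) (by omega)

/-! ### Automorphism groups and the size of isomorphism classes. -/

/-- If the adjacencies to `t` vertices determine every vertex, then the images of these vertices
determine every automorphism. -/
theorem card_automorphisms_le {V : Type*} [Finite V] (Γ : SimpleGraph V) {t : ℕ} (f : Fin t → V)
    (hf : ∀ x y, (∀ j, Γ.Adj x (f j) ↔ Γ.Adj y (f j)) → x = y) :
    Nat.card (Γ ≃g Γ) ≤ Nat.card V ^ t := by
  have hinj : Function.Injective fun (φ : Γ ≃g Γ) (j : Fin t) => φ (f j) := by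
    intro φ ψ h
    ext x
    -- ψ⁻¹φ is an automorphism fixing every `f j`, so it preserves adjacency to each of them.
    have hx : ψ.symm (φ x) = x := by
      refine hf _ _ fun j => ?_
      have hj : φ (f j) = ψ (f j) := congrFun h j
      rw [← ψ.map_adj_iff, ← φ.map_adj_iff (v := x), hj]
      simp
    exact (ψ.symm_apply_eq.1 hx)
  calc _ ≤ Nat.card (Fin t → V) := Nat.card_le_card_of_injective _ hinj
    _ = _ := by simp [Nat.card_fun]

/-- The inverse-closed subsets of `A \ B`. -/
def bipartiteConnectionSets {A : Type*} [CommGroup A] (B : Subgroup A) : Set (Set A) :=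
  {S | S⁻¹ = S ∧ S ⊆ (B : Set A)ᶜ}

section

variable {A : Type*} [CommGroup A] {B : Subgroup A}

theorem mulCayley_adj_iff_of_mem {S : Set A} (hS : S ∈ bipartiteConnectionSets B) (g h : A) :
    (SimpleGraph.mulCayley S).Adj g h ↔ g * h⁻¹ ∈ S :=
  mulCayley_adj_iff_of_inv_eq hS.1 (fun h1 => hS.2 h1 B.one_mem) g h

theorem injOn_mulCayley : Set.InjOn (fun S : Set A => SimpleGraph.mulCayley S) (bipartiteConnectionSets B) := by
  intro S hS T hT h
  dsimp only at h
  ext x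
  have h1 := mulCayley_adj_iff_of_mem hS x 1
  have h2 := mulCayley_adj_iff_of_mem hT x 1
  simp only [inv_one, mul_one] at h1 h2
  rw [← h1, ← h2, h]

theorem bipartiteCayleyGraphs_eq_image (hB : B.index = 2) :
    bipartiteCayleyGraphs B =
      (fun S : Set A => SimpleGraph.mulCayley S) '' bipartiteConnectionSets B := by
  ext Γ
  rw [mem_bipartiteCayleyGraphs_iff hB]
  constructor
  · rintro ⟨S, h1, h2, rfl⟩
    exact ⟨S, ⟨h1, h2⟩, rfl⟩
  · rintro ⟨S, ⟨h1, h2⟩, rfl⟩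
    exact ⟨S, h1, h2, rfl⟩

/-- Translations are automorphisms of Cayley graphs. -/
def mulLeftIso {S : Set A} (hS : S ∈ bipartiteConnectionSets B) (a : A) :
    SimpleGraph.mulCayley S ≃g SimpleGraph.mulCayley S where
  toEquiv := Equiv.mulLeft a
  map_rel_iff' := by
    intro x y
    rw [mulCayley_adj_iff_of_mem hS, mulCayley_adj_iff_of_mem hS]
    have : a * x * (a * y)⁻¹ = x * y⁻¹ := by
      rw [mul_inv, mul_mul_mul_comm, mul_inv_cancel, one_mul]
    change a * x * (a * y)⁻¹ ∈ S ↔ _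
    rw [this]

/-- The number of connection sets whose Cayley graph is isomorphic to `Γ`. -/
theorem ncard_connectionSets_iso_le [Finite A] (Γ : SimpleGraph A) {r : ℕ} (g : Fin r → A)
    (hg : Subgroup.closure (Set.range g) = ⊤) :
    {S ∈ bipartiteConnectionSets B | Nonempty (SimpleGraph.mulCayley S ≃g Γ)}.ncard ≤
      Nat.card A * Nat.card (Γ ≃g Γ) ^ r := by
  classical
  set C := {S ∈ bipartiteConnectionSets B | Nonempty (SimpleGraph.mulCayley S ≃g Γ)} with hC
  have hCB : ∀ S : C, S.1 ∈ bipartiteConnectionSets B := fun S => S.2.1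
  have φ : ∀ S : C, SimpleGraph.mulCayley S.1 ≃g Γ := fun S => S.2.2.some
  have : Finite (Γ ≃g Γ) := DFunLike.finite _
  -- Conjugating by φ_S carries the translations to automorphisms of Γ. Those coming from generators
  -- give all of them, and φ_S(x) is the conjugate of translation by x applied to φ_S(1); hence
  -- these data determine φ_S, and so S.
  let F : C → A × (Fin r → (Γ ≃g Γ)) := fun S =>
    (φ S 1, fun i => ((φ S).symm.trans (mulLeftIso (hCB S) (g i))).trans (φ S))
  have hinj : Function.Injective F := by
    intro S T h
    have h1 : φ S 1 = φ T 1 := congrArg Prod.fst h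
    have h2 : ∀ i a, φ S (g i * (φ S).symm a) = φ T (g i * (φ T).symm a) := fun i a =>
      congrArg (fun ρ : Γ ≃g Γ => ρ a) (congrFun (congrArg Prod.snd h) i)
    let H : Subgroup A :=
      { carrier := {x | ∀ a, φ S (x * (φ S).symm a) = φ T (x * (φ T).symm a)}
        one_mem' := by intro a; simp
        mul_mem' := by
          intro x y hx hy a
          have := hx (φ S (y * (φ S).symm a))
          rw [hy a] at this
          simp only [RelIso.symm_apply_apply] at this
          rw [mul_assoc, mul_assoc, ← this, ← hy a, RelIso.symm_apply_apply]
        inv_mem' := by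
          intro x hx a
          have := hx (φ T (x⁻¹ * (φ T).symm a))
          simp only [RelIso.symm_apply_apply, mul_inv_cancel_left, RelIso.apply_symm_apply] at this
          have h3 := congrArg (fun z => φ S (x⁻¹ * (φ S).symm z)) this
          simpa using h3.symm }
    have hH : H = ⊤ := by
      rw [eq_top_iff, ← hg, Subgroup.closure_le]
      rintro _ ⟨i, rfl⟩
      exact h2 i
    have h3 : ∀ x, φ S x = φ T x := by
      intro x
      have hx : x ∈ H := hH ▸ Subgroup.mem_top x
      have := hx (φ S 1)
      rw [RelIso.symm_apply_apply, h1, RelIso.symm_apply_apply] at this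
      simpa using this
    refine Subtype.ext (injOn_mulCayley (hCB S) (hCB T) ?_)
    ext x y
    rw [← (φ S).map_adj_iff, ← (φ T).map_adj_iff, h3, h3]
  calc C.ncard = Nat.card C := rfl
    _ ≤ Nat.card (A × (Fin r → (Γ ≃g Γ))) := Nat.card_le_card_of_injective F hinj
    _ = _ := by simp [Nat.card_fun, Nat.card_prod]

end

/-! ### Counting connection sets and almost invariant connection sets. -/

section

variable {A : Type*} [CommGroup A] {B : Subgroup A}

/-- A set of representatives, chosen by means of an injection `ρ` into `ℕ`, of the pairs
`{u, u⁻¹}` in `A \ B`. -/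
def inverseTransversal (ρ : A → ℕ) (B : Subgroup A) : Set A :=
  {u | u ∉ B ∧ ρ u ≤ ρ u⁻¹}

theorem mem_or_inv_mem_inverseTransversal (ρ : A → ℕ) {u : A} (hu : u ∉ B) :
    u ∈ inverseTransversal ρ B ∨ u⁻¹ ∈ inverseTransversal ρ B := by
  simp only [inverseTransversal, Set.mem_ofPred_eq, inv_mem_iff, hu, not_false_eq_true, true_and,
    inv_inv]
  exact le_total _ _

theorem inv_mem_iff_of_mem {S : Set A} (hS : S ∈ bipartiteConnectionSets B) (u : A) :
    u⁻¹ ∈ S ↔ u ∈ S := by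
  rw [← Set.mem_inv, hS.1]

theorem eq_of_inter_inverseTransversal_eq (ρ : A → ℕ) {S T : Set A}
    (hS : S ∈ bipartiteConnectionSets B) (hT : T ∈ bipartiteConnectionSets B)
    (h : S ∩ inverseTransversal ρ B = T ∩ inverseTransversal ρ B) : S = T := by
  have hK : ∀ u ∈ inverseTransversal ρ B, u ∈ S ↔ u ∈ T := fun u hu => by
    have := Set.ext_iff.1 h u
    simpa [hu] using this
  ext u
  by_cases hu : u ∈ B
  · exact iff_of_false (fun h => hS.2 h hu) (fun h => hT.2 h hu)
  · rcases mem_or_inv_mem_inverseTransversal ρ hu with h | h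
    · exact hK u h
    · rw [← inv_mem_iff_of_mem hS, ← inv_mem_iff_of_mem hT]
      exact hK _ h

theorem ncard_bipartiteConnectionSets [Finite A] {ρ : A → ℕ} (hρ : Function.Injective ρ) :
    (bipartiteConnectionSets B).ncard = 2 ^ (inverseTransversal ρ B).ncard := by
  set K := inverseTransversal ρ B with hK
  have himage : (fun S => S ∩ K) '' bipartiteConnectionSets B = 𝒫 K := by
    ext Y
    constructor
    · rintro ⟨S, -, rfl⟩
      exact Set.inter_subset_right
    · intro hY
      refine ⟨Y ∪ Y⁻¹, ⟨by simp [Set.union_comm], ?_⟩, ?_⟩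
      · rintro u (hu | hu)
        · exact (hY hu).1
        · have := (hY hu).1
          rwa [inv_mem_iff] at this
      · ext u
        constructor
        · rintro ⟨hu | hu, huK⟩
          · exact hu
          · have h1 := (hY hu).2
            rw [inv_inv] at h1
            have : u⁻¹ = u := hρ (le_antisymm h1 huK.2)
            rw [← this]
            exact hu
        · intro hu
          exact ⟨Or.inl hu, hY hu⟩
  rw [← Set.ncard_powerset K, ← himage, Set.InjOn.ncard_image]
  intro S hS T hT h
  exact eq_of_inter_inverseTransversal_eq ρ hS hT h

theorem two_mul_ncard_compl [Finite A] (hB : B.index = 2) :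
    2 * ((B : Set A)ᶜ).ncard = Nat.card A := by
  have h1 := Set.ncard_add_ncard_compl (B : Set A)
  have h2 := B.card_mul_index
  have h3 : (B : Set A).ncard = Nat.card B := rfl
  rw [hB] at h2
  omega

/-- Inclusion–exclusion for K and K⁻¹: their union is A \ B, and an element lies in both exactly
when it is its own inverse. -/
theorem four_mul_ncard_inverseTransversal [Finite A] (hB : B.index = 2) {ρ : A → ℕ}
    (hρ : Function.Injective ρ) :
    4 * (inverseTransversal ρ B).ncard = Nat.card A + 2 * {a : A | a ^ 2 = 1 ∧ a ∉ B}.ncard := by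
  set K := inverseTransversal ρ B with hK
  have hu : K ∪ K⁻¹ = (B : Set A)ᶜ := by
    ext u
    constructor
    · rintro (hu | hu)
      · exact hu.1
      · have := hu.1
        rwa [inv_mem_iff] at this
    · exact fun hu => mem_or_inv_mem_inverseTransversal ρ hu
  have hi : K ∩ K⁻¹ = {a : A | a ^ 2 = 1 ∧ a ∉ B} := by
    ext u
    constructor
    · rintro ⟨h1, h2⟩
      refine ⟨?_, h1.1⟩
      have h3 := h2.2
      rw [inv_inv] at h3
      rw [sq, mul_eq_one_iff_eq_inv]
      exact hρ (le_antisymm h1.2 h3)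
    · rintro ⟨h1, h2⟩
      rw [sq, mul_eq_one_iff_eq_inv] at h1
      have hm : u ∈ K := ⟨h2, by rw [← h1]⟩
      exact ⟨hm, by rwa [Set.mem_inv, ← h1]⟩
  have h1 := Set.ncard_union_add_ncard_inter K K⁻¹
  rw [hu, hi, Set.ncard_inv] at h1
  have h2 := two_mul_ncard_compl hB
  omega

/-- If membership in the sets of `C` can be propagated to `E` from smaller elements of `K`, then
the sets are determined by their traces on `K \ E` and the data `D`. -/
theorem ncard_le_of_propagation {α : Type*} [Finite α] {C Ds : Set (Set α)} {K E : Set α}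
    (hK : ∀ S ∈ C, ∀ T ∈ C, S ∩ K = T ∩ K → S = T) (q : α → ℕ) (e x : α → α)
    (D : Set α → Set α) (he : ∀ u ∈ E, e u ∈ K) (hq : ∀ u ∈ E, q (e u) < q u)
    (hx : ∀ u ∈ E, ∀ S ∈ C, x u ∈ D S ↔ ¬ (u ∈ S ↔ e u ∈ S)) (hD : ∀ S ∈ C, D S ∈ Ds) :
    C.ncard ≤ 2 ^ (K \ E).ncard * Ds.ncard := by
  rw [← Set.ncard_powerset (K \ E), ← Set.ncard_prod]
  refine Set.ncard_le_ncard_of_injOn (fun S => (S ∩ (K \ E), D S)) ?_ ?_ (Set.toFinite _)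
  · intro S hS
    exact ⟨Set.inter_subset_right, hD S hS⟩
  · intro S hS T hT h
    have h1 : S ∩ (K \ E) = T ∩ (K \ E) := congrArg Prod.fst h
    have h2 : D S = D T := congrArg Prod.snd h
    -- Strong induction on `q`: for u in E, the common value of D at `x u` tells whether u and the
    -- earlier `e u` agree.
    have key : ∀ N u, q u = N → u ∈ K → (u ∈ S ↔ u ∈ T) := by
      intro N
      induction N using Nat.strong_induction_on with
      | _ N ih =>
        intro u hN hu
        by_cases huE : u ∈ E
        · have h3 := ih (q (e u)) (hN ▸ hq u huE) (e u) rfl (he u huE)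
          have h4 := hx u huE S hS
          have h5 := hx u huE T hT
          rw [h2] at h4
          tauto
        · have := Set.ext_iff.1 h1 u
          simpa [hu, huE] using this
    refine hK S hS T hT ?_
    ext u
    by_cases hu : u ∈ K
    · simpa [hu] using key _ u rfl hu
    · simp [hu]

open Classical in
/-- The representative of `{u, u⁻¹}` in `inverseTransversal`. -/
noncomputable def inverseRep (ρ : A → ℕ) (u : A) : A := if ρ u ≤ ρ u⁻¹ then u else u⁻¹

theorem inverseRep_eq_or (ρ : A → ℕ) (u : A) :
    inverseRep ρ u = u ∨ inverseRep ρ u = u⁻¹ := by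
  unfold inverseRep
  split_ifs <;> simp

theorem inverseRep_mem (ρ : A → ℕ) {u : A} (hu : u ∉ B) :
    inverseRep ρ u ∈ inverseTransversal ρ B := by
  unfold inverseRep
  split_ifs with h
  · exact ⟨hu, h⟩
  · refine ⟨by rwa [inv_mem_iff], ?_⟩
    rw [inv_inv]
    omega

theorem inverseRep_mem_iff (ρ : A → ℕ) {S : Set A} (hS : S ∈ bipartiteConnectionSets B) (u : A) :
    inverseRep ρ u ∈ S ↔ u ∈ S := by
  rcases inverseRep_eq_or ρ u with h | h <;> rw [h]
  exact inv_mem_iff_of_mem hS u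

/-- Few connection sets are almost invariant under translation by `d`. -/
theorem ncard_almost_invariant_le [Finite A] (hB : B.index = 2) {ρ : A → ℕ}
    (hρ : Function.Injective ρ) {d : A} (hdB : d ∈ B) (hd : d ≠ 1)
    (hsq : 4 * {v : A | v ∉ B ∧ v ^ 2 = d⁻¹}.ncard ≤ Nat.card A) (m : ℕ) :
    {S ∈ bipartiteConnectionSets B | (symmDiff S (d • S)).ncard ≤ m}.ncard *
      2 ^ (Nat.card A / 16) ≤ 2 ^ (inverseTransversal ρ B).ncard * (Nat.card A + 1) ^ m := by
  classical
  set K := inverseTransversal ρ B with hK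
  set C := {S ∈ bipartiteConnectionSets B | (symmDiff S (d • S)).ncard ≤ m} with hC
  -- For v outside B, translation by d sends the pair of v to itself only if d = 1 or vd = v⁻¹. W
  -- consists of the pairs having a member v for which the latter fails.
  let W : Set A := {u ∈ K | ∃ v, (v = u ∨ v = u⁻¹) ∧ v ^ 2 ≠ d⁻¹}
  have hv : ∀ u, ∃ v, u ∈ W → (v = u ∨ v = u⁻¹) ∧ v ^ 2 ≠ d⁻¹ := by
    intro u
    by_cases hu : u ∈ W
    · obtain ⟨v, h⟩ := hu.2
      exact ⟨v, fun _ => h⟩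
    · exact ⟨u, fun h => absurd h hu⟩
  choose v hv using hv
  let e : A → A := fun u => inverseRep ρ (v u * d)
  have hvB : ∀ u ∈ W, v u ∉ B := by
    intro u hu
    have huB : u ∉ B := hu.1.1
    rcases (hv u hu).1 with h | h <;> rw [h]
    · exact huB
    · rwa [inv_mem_iff]
  have heK : ∀ u ∈ W, e u ∈ K := by
    intro u hu
    refine inverseRep_mem ρ fun h => hvB u hu ?_
    rwa [B.mul_mem_cancel_right hdB] at h
  have hne : ∀ u ∈ W, e u ≠ u := by
    intro u hu heq
    have h1 : v u * d = u ∨ v u * d = u⁻¹ := by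
      rcases inverseRep_eq_or ρ (v u * d) with h | h
      · exact Or.inl (h.symm.trans heq)
      · exact Or.inr (by rw [← inv_inv (v u * d), ← h]; exact congrArg _ heq)
    have h2 : v u * d = v u ∨ v u * d = (v u)⁻¹ := by
      rcases (hv u hu).1 with h | h
      · rwa [h] at h1 ⊢
      · rw [h] at h1 ⊢
        rw [inv_inv]
        exact h1.symm
    rcases h2 with h | h
    · exact hd (mul_eq_left.1 h)
    · apply (hv u hu).2
      rw [eq_inv_iff_mul_eq_one, sq, mul_assoc, h, mul_inv_cancel]
  have hx : ∀ u ∈ W, ∀ S ∈ C, v u * d ∈ symmDiff S (d • S) ↔ ¬ (u ∈ S ↔ e u ∈ S) := by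
    intro u hu S hS
    have h1 : u ∈ S ↔ v u ∈ S := by
      rcases (hv u hu).1 with h | h <;> rw [h]
      exact (inv_mem_iff_of_mem hS.1 u).symm
    have h2 : v u * d ∈ d • S ↔ v u ∈ S := by
      rw [mul_comm, ← smul_eq_mul, Set.smul_mem_smul_set_iff]
    rw [Set.mem_symmDiff, h1, inverseRep_mem_iff ρ hS.1, h2]
    tauto
  obtain ⟨N, hN⟩ : ∃ N, ∀ u, ρ u ≤ N := by
    obtain ⟨N, hN⟩ := (Set.finite_range ρ).bddAbove
    exact ⟨N, fun u => hN ⟨u, rfl⟩⟩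
  have hKdet : ∀ S ∈ C, ∀ T ∈ C, S ∩ K = T ∩ K → S = T := fun S hS T hT h =>
    eq_of_inter_inverseTransversal_eq ρ hS.1 hT.1 h
  -- Of the n/2 elements of A \ B, at most n/4 satisfy v² = d⁻¹; W ∪ W⁻¹ covers the rest.
  have hZ : Nat.card A ≤ 8 * W.ncard := by
    have h1 : (B : Set A)ᶜ ⊆ {v : A | v ∉ B ∧ v ^ 2 = d⁻¹} ∪ (W ∪ W⁻¹) := by
      intro u hu
      by_cases h : u ^ 2 = d⁻¹
      · exact Or.inl ⟨hu, h⟩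
      · right
        rcases mem_or_inv_mem_inverseTransversal ρ hu with h' | h'
        · exact Or.inl ⟨h', u, Or.inl rfl, h⟩
        · exact Or.inr ⟨h', u, Or.inr (inv_inv u).symm, h⟩
    have h2 := Set.ncard_le_ncard h1 (Set.toFinite _)
    have h3 := Set.ncard_union_le {v : A | v ∉ B ∧ v ^ 2 = d⁻¹} (W ∪ W⁻¹)
    have h4 := Set.ncard_union_le W W⁻¹
    rw [Set.ncard_inv] at h4
    have h5 := two_mul_ncard_compl hB
    omega
  have main : ∀ (E : Set A) (q : A → ℕ), E ⊆ W → (∀ u ∈ E, q (e u) < q u) →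
      Nat.card A ≤ 16 * E.ncard → C.ncard * 2 ^ (Nat.card A / 16) ≤
        2 ^ K.ncard * (Nat.card A + 1) ^ m := by
    intro E q hEW hq hE
    have h1 := ncard_le_of_propagation (Ds := {D | D.ncard ≤ m}) hKdet q e (fun u => v u * d)
      (fun S => symmDiff S (d • S)) (fun u hu => heK u (hEW hu)) hq
      (fun u hu => hx u (hEW hu)) (fun S hS => hS.2)
    have h2 : (K \ E).ncard + E.ncard = K.ncard :=
      Set.ncard_sdiff_add_ncard_of_subset (fun u hu => (hEW hu).1) (Set.toFinite _)
    calc C.ncard * 2 ^ (Nat.card A / 16)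
        ≤ 2 ^ (K \ E).ncard * (Nat.card A + 1) ^ m * 2 ^ E.ncard := by
          refine Nat.mul_le_mul (h1.trans ?_) (Nat.pow_le_pow_right (by norm_num) (by omega))
          exact Nat.mul_le_mul_left _ (ncard_setOf_ncard_le m)
      _ = _ := by rw [← h2, pow_add]; ring
  -- Propagation must follow a well-founded order. Either ρ decreases along `e` on half of W, or it
  -- increases there and N - ρ serves instead; both ways n/16 choices are saved.
  have hE : W ⊆ {u ∈ W | ρ (e u) < ρ u} ∪ {u ∈ W | ρ u < ρ (e u)} := by
    intro u hu
    rcases lt_trichotomy (ρ (e u)) (ρ u) with h | h | h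
    · exact Or.inl ⟨hu, h⟩
    · exact absurd (hρ h) (hne u hu)
    · exact Or.inr ⟨hu, h⟩
  have hE1 := Set.ncard_le_ncard hE (Set.toFinite _)
  have hE2 := Set.ncard_union_le {u ∈ W | ρ (e u) < ρ u} {u ∈ W | ρ u < ρ (e u)}
  by_cases hlarge : Nat.card A ≤ 16 * {u ∈ W | ρ (e u) < ρ u}.ncard
  · exact main _ ρ (fun u hu => hu.1) (fun u hu => hu.2) hlarge
  · refine main {u ∈ W | ρ u < ρ (e u)} (fun u => N - ρ u) (fun u hu => hu.1) (fun u hu => ?_)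
      (by omega)
    have := hu.2
    have := hN (e u)
    omega

end

/-! ### Determining tuples and the exclusion of exceptional pairs. -/

section

variable {A : Type*} [CommGroup A] {B : Subgroup A}

/-- The neighbourhood of x is xS. For x, y in one coset of B, xS ∆ yS is a translate of S ∆ dS with
d = x⁻¹y; otherwise xS and yS lie in different cosets and are disjoint. The factor 2 in `hm` gives m
≤ |S| for this second case. A tuple meeting all these differences separates the vertices. -/
theorem exists_determining_tuple [Finite A] (hB : B.index = 2) {S : Set A}
    (hS : S ∈ bipartiteConnectionSets B) (m t : ℕ)
    (hm : ∀ d ∈ B, d ≠ 1 → 2 * m < (symmDiff S (d • S)).ncard) (hA : 2 < Nat.card A)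
    (ht : Nat.card A ^ 2 * (Nat.card A - m) ^ t < Nat.card A ^ t) :
    ∃ f : Fin t → A, ∀ x y, (∀ j, (SimpleGraph.mulCayley S).Adj x (f j) ↔
      (SimpleGraph.mulCayley S).Adj y (f j)) → x = y := by
  classical
  have := Fintype.ofFinite A
  have hSm : m ≤ S.ncard := by
    obtain ⟨d, hdB, hd⟩ : ∃ d ∈ B, d ≠ 1 := by
      apply B.bot_or_exists_ne_one.resolve_left
      rintro rfl
      rw [Subgroup.index_bot] at hB
      omega
    have h1 := hm d hdB hd
    have h2 : (symmDiff S (d • S)).ncard ≤ (S ∪ d • S).ncard :=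
      Set.ncard_le_ncard symmDiff_le_sup (Set.toFinite _)
    have h3 := Set.ncard_union_le S (d • S)
    rw [Set.ncard_smul_set] at h3
    omega
  have hadj : ∀ x z, (SimpleGraph.mulCayley S).Adj x z ↔ z ∈ x • S := by
    intro x z
    rw [mulCayley_adj_iff_of_mem hS, Set.mem_smul_set_iff_inv_smul_mem, smul_eq_mul,
      ← inv_mem_iff_of_mem hS, mul_inv, inv_inv]
  have hlarge : ∀ x y : A, x ≠ y → m ≤ (symmDiff (x • S) (y • S)).ncard := by
    intro x y hxy
    by_cases hxyB : x⁻¹ * y ∈ B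
    · have h1 := hm _ hxyB fun h => hxy (inv_mul_eq_one.1 h)
      have h2 : symmDiff (x • S) (y • S) = x • symmDiff S ((x⁻¹ * y) • S) := by
        rw [Set.smul_set_symmDiff, smul_smul, mul_inv_cancel_left]
      rw [h2, Set.ncard_smul_set]
      omega
    · have h1 : Disjoint (x • S) (y • S) := by
        rw [Set.disjoint_left]
        intro z hzx hzy
        rw [Set.mem_smul_set_iff_inv_smul_mem] at hzx hzy
        have h3 := hS.2 hzx
        have h4 := hS.2 hzy
        apply hxyB
        have h5 : x⁻¹ * y = (x⁻¹ • z) * (y⁻¹ • z)⁻¹ := by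
          simp only [smul_eq_mul, mul_inv, inv_inv]
          rw [mul_mul_mul_comm, mul_inv_cancel, mul_one]
        rw [h5, Subgroup.mul_mem_iff_of_index_two hB, inv_mem_iff]
        exact iff_of_false h3 h4
      have h2 : x • S ⊆ symmDiff (x • S) (y • S) := fun z hz =>
        Or.inl ⟨hz, Set.disjoint_left.1 h1 hz⟩
      have h3 := Set.ncard_le_ncard h2 (Set.toFinite _)
      rw [Set.ncard_smul_set] at h3
      omega
  let U : {p : A × A // p.1 ≠ p.2} → Finset A := fun p =>
    (symmDiff (p.1.1 • S) (p.1.2 • S)).toFinset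
  have hU : ∀ p, m ≤ (U p).card := by
    intro p
    have := hlarge p.1.1 p.1.2 p.2
    rwa [Set.ncard_eq_toFinset_card'] at this
  obtain ⟨f, hf⟩ := exists_tuple_hitting U m t hU <| by
    refine lt_of_le_of_lt (Nat.mul_le_mul_right _ ?_) (Nat.card_eq_fintype_card (α := A) ▸ ht)
    refine (Fintype.card_subtype_le _).trans ?_
    rw [Fintype.card_prod, sq]
  refine ⟨f, fun x y h => ?_⟩
  by_contra hxy
  obtain ⟨j, hj⟩ := hf ⟨(x, y), hxy⟩
  have h1 := h j
  rw [hadj, hadj] at h1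
  rw [Set.mem_toFinset, Set.mem_symmDiff] at hj
  tauto

/-- If the subgroup of index two has exponent two and `A` does not, then the pair is
exceptional. -/
theorem isExceptionalPair_of_forall_sq_eq_one [Finite A] (hB : B.index = 2)
    (hA : 4 < Nat.card A) (hsq : ∀ b ∈ B, b ^ 2 = 1) {t : A} (ht : t ∉ B) (ht2 : t ^ 2 ≠ 1) :
    IsExceptionalPair B := by
  classical
  have htB : t ^ 2 ∈ B := Subgroup.sq_mem_of_index_two hB t
  let _ : Module (ZMod 2) (Additive B) := AddCommGroup.zmodModule fun x => by
    have := hsq x.toMul x.toMul.2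
    apply Additive.toMul.injective
    apply Subtype.ext
    exact this
  let c : Additive B := Additive.ofMul ⟨t ^ 2, htB⟩
  have hc : c ≠ 0 := by
    intro h
    apply ht2
    exact congrArg Subtype.val (congrArg Additive.toMul h)
  -- B is a vector space over the field of two elements. With W a complement of the line of t², A is
  -- the direct product of ⟨t⟩ ≅ C₄ and W.
  obtain ⟨W, hW⟩ := Submodule.exists_isCompl (Submodule.span (ZMod 2) {c})
  have hcW : c ∉ W := by
    intro h
    have := hW.disjoint.le_bot (x := c) ⟨Submodule.mem_span_singleton_self c, h⟩
    exact hc (by simpa using this)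
  set l := Module.finrank (ZMod 2) W with hl
  have hrank : Module.finrank (ZMod 2) (Additive B) = l + 1 := by
    have := Submodule.finrank_add_eq_of_isCompl hW
    rw [finrank_span_singleton hc] at this
    omega
  let eB : Additive B ≃ₗ[ZMod 2] (Fin (l + 1) → ZMod 2) :=
    LinearEquiv.ofFinrankEq _ _ (by simp [hrank])
  let eW : (Fin l → ZMod 2) ≃ₗ[ZMod 2] W := LinearEquiv.ofFinrankEq _ _ (by simp [hl])
  have hcardB : Nat.card B = 2 ^ (l + 1) := by
    rw [← Nat.card_congr (Additive.ofMul (α := B)).symm, Nat.card_congr eB.toEquiv]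
    simp
  have hcardA : Nat.card A = 2 ^ (l + 2) := by
    rw [← B.card_mul_index, hB, hcardB, pow_succ 2 (l + 1)]
  have ht4 : t ^ 4 = 1 := by
    have := hsq _ htB
    rwa [← pow_mul] at this
  let τ : ZMod 4 →+ Additive A := ZMod.lift 4 ⟨zmultiplesHom (Additive A) (Additive.ofMul t), by
    change (Additive.ofMul (t ^ (4 : ℤ)) : Additive A) = 0
    exact congrArg Additive.ofMul (by exact_mod_cast ht4)⟩
  let ω : (Fin l → ZMod 2) →+ Additive A :=
    (MonoidHom.toAdditive B.subtype).comp (W.subtype.toAddMonoidHom.comp eW.toLinearMap.toAddMonoidHom)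
  have hωB : ∀ w, (ω w).toMul ∈ B := fun w => ((eW w : Additive B).toMul).2
  have hω0 : ∀ w, ω w = 0 → w = 0 := by
    intro w hw
    have : (eW w : Additive B) = 0 := Additive.toMul.injective (Subtype.ext hw)
    simpa using this
  have hωc : ∀ w, (ω w).toMul ≠ t ^ 2 := by
    intro w hw
    apply hcW
    have : (eW w : Additive B) = c := Additive.toMul.injective (Subtype.ext hw)
    rw [← this]
    exact (eW w).2
  have hτ : ∀ k : ℤ, (τ k).toMul = t ^ k := by
    intro k
    simp [τ]
  let ψ : ZMod 4 × (Fin l → ZMod 2) →+ Additive A := τ.coprod ω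
  have hinj : Function.Injective ψ := by
    rw [injective_iff_map_eq_zero]
    rintro ⟨k, w⟩ h
    have h1 : (τ k).toMul * (ω w).toMul = 1 := h
    have h2 : (τ k).toMul ∈ B := by
      have h3 := hωB w
      rw [eq_inv_of_mul_eq_one_left h1]
      exact B.inv_mem h3
    have h4 : k = 0 ∨ k = 1 ∨ k = 2 ∨ k = 3 := by
      clear * -; revert k; decide
    rcases h4 with rfl | rfl | rfl | rfl
    · rw [map_zero, toMul_zero, one_mul] at h1
      rw [hω0 w h1]
      rfl
    · have := hτ 1
      simp only [Int.cast_one, zpow_one] at this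
      exact absurd (this ▸ h2) ht
    · have h5 : (τ 2).toMul = t ^ 2 := by exact_mod_cast hτ 2
      rw [h5] at h1
      refine absurd ?_ (hωc w)
      rw [eq_inv_of_mul_eq_one_right h1, inv_eq_iff_mul_eq_one, ← sq, hsq _ htB]
    · have h5 : (τ 3).toMul = t ^ 3 := by exact_mod_cast hτ 3
      rw [h5, pow_succ, B.mul_mem_cancel_left htB] at h2
      exact absurd h2 ht
  have hbij : Function.Bijective ψ := by
    have : Finite (Additive A) := inferInstanceAs (Finite A)
    rw [Nat.bijective_iff_injective_and_card]
    refine ⟨hinj, ?_⟩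
    change _ = Nat.card A
    rw [hcardA]
    simp [pow_succ]
    ring
  refine Or.inl ⟨l, ?_, ⟨?_⟩, ⟨?_⟩⟩
  · by_contra! h
    interval_cases l
    omega
  · exact (AddEquiv.toMultiplicativeLeft (AddEquiv.ofBijective ψ hbij)).symm
  · exact AddEquiv.toMultiplicativeRight eB.toAddEquiv

/-- Outside the exceptional pairs, squaring is far from constant on `A \ B`, except possibly with
value `1`. -/
theorem four_mul_ncard_sq_eq_le [Finite A] (hB : B.index = 2) (hA : 4 < Nat.card A)
    (hex : ¬ IsExceptionalPair B) {c : A} (hc : c ≠ 1) :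
    4 * {v : A | v ∉ B ∧ v ^ 2 = c}.ncard ≤ Nat.card A := by
  by_contra! hlt
  obtain ⟨t, htB, htc⟩ : {v : A | v ∉ B ∧ v ^ 2 = c}.Nonempty := by
    rw [← Set.ncard_pos]
    omega
  refine hex (isExceptionalPair_of_forall_sq_eq_one hB hA ?_ htB (htc ▸ hc))
  let H : Subgroup B := (powMonoidHom 2 : B →* B).ker
  -- Dividing by the fixed solution t sends the solutions injectively into the 2-torsion H of B.
  -- More than n/4 = |B|/2 of them then force H = B by Lagrange.
  have hle : {v : A | v ∉ B ∧ v ^ 2 = c}.ncard ≤ Nat.card H := by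
    refine Nat.card_le_card_of_injective
      (fun v : {v : A | v ∉ B ∧ v ^ 2 = c} => (⟨⟨v.1 * t⁻¹, ?_⟩, ?_⟩ : H)) ?_
    · rw [Subgroup.mul_mem_iff_of_index_two hB, inv_mem_iff]
      exact iff_of_false v.2.1 htB
    · rw [MonoidHom.mem_ker]
      apply Subtype.ext
      change (v.1 * t⁻¹) ^ 2 = 1
      rw [mul_pow, v.2.2, inv_pow, htc, mul_inv_cancel]
    · intro v w h
      have := congrArg (fun z : H => z.1.1) h
      exact Subtype.ext (mul_right_cancel this)
  have hH : H = ⊤ := by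
    obtain ⟨q, hq⟩ := H.card_subgroup_dvd_card
    have h1 := B.card_mul_index
    rw [hB] at h1
    have h2 : 0 < Nat.card H := Nat.card_pos
    have h3 : q < 2 := by
      by_contra! hq2
      have := Nat.mul_le_mul_left (Nat.card H) hq2
      omega
    have h4 : 0 < Nat.card B := Nat.card_pos
    interval_cases q
    · omega
    · exact Subgroup.eq_top_of_card_eq _ (by omega)
  intro b hb
  have : (⟨b, hb⟩ : B) ∈ H := hH ▸ Subgroup.mem_top _
  exact congrArg Subtype.val (MonoidHom.mem_ker.1 this)

end

/-! ### The lower bound with explicit error. -/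

section

variable {A : Type*} [CommGroup A] {B : Subgroup A}

theorem numUnlabelled_le (A : Type*) [CommGroup A] [Finite A] {B : Subgroup A} (hB : B.index = 2) :
    numUnlabelledBipartiteCayleyGraphs B ≤ (bipartiteConnectionSets B).ncard := by
  unfold numUnlabelledBipartiteCayleyGraphs
  rw [bipartiteCayleyGraphs_eq_image hB, Set.image_image]
  exact Set.ncard_image_le (Set.toFinite _)

/-- Connection sets far from invariant under every translation by a nontrivial element of `B` give
small isomorphism classes. -/
theorem ncard_good_le [Finite A] (hB : B.index = 2) (m t r : ℕ) (hA : 2 < Nat.card A)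
    (ht : Nat.card A ^ 2 * (Nat.card A - m) ^ t < Nat.card A ^ t) (g : Fin r → A)
    (hg : Subgroup.closure (Set.range g) = ⊤) :
    {S ∈ bipartiteConnectionSets B |
      ∀ d ∈ B, d ≠ 1 → 2 * m < (symmDiff S (d • S)).ncard}.ncard ≤
      Nat.card A * (Nat.card A ^ t) ^ r * numUnlabelledBipartiteCayleyGraphs B := by
  classical
  set G := {S ∈ bipartiteConnectionSets B |
    ∀ d ∈ B, d ≠ 1 → 2 * m < (symmDiff S (d • S)).ncard} with hG
  let π : Set A → Quotient (graphIsoSetoid A) := fun S =>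
    Quotient.mk (graphIsoSetoid A) (SimpleGraph.mulCayley S)
  have hfin : G.Finite := Set.toFinite _
  have h1 := Finset.card_le_mul_card_image (f := π) hfin.toFinset
    (Nat.card A * (Nat.card A ^ t) ^ r) ?_
  · rw [Set.ncard_eq_toFinset_card G hfin]
    refine h1.trans (Nat.mul_le_mul_left _ ?_)
    unfold numUnlabelledBipartiteCayleyGraphs
    rw [← Set.ncard_coe_finset]
    refine Set.ncard_le_ncard ?_ (Set.toFinite _)
    intro z hz
    simp only [Finset.coe_image, Set.Finite.coe_toFinset] at hz
    obtain ⟨S, hS, rfl⟩ := hz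
    rw [bipartiteCayleyGraphs_eq_image hB]
    exact ⟨_, ⟨S, hS.1, rfl⟩, rfl⟩
  · intro z hz
    simp only [Finset.mem_image, Set.Finite.mem_toFinset] at hz
    obtain ⟨S, hS, rfl⟩ := hz
    obtain ⟨f, hf⟩ := exists_determining_tuple hB hS.1 m t hS.2 hA ht
    have h2 := card_automorphisms_le _ f hf
    have h3 := ncard_connectionSets_iso_le (B := B) (SimpleGraph.mulCayley S) g hg
    refine le_trans ?_ (h3.trans (Nat.mul_le_mul_left _ (Nat.pow_le_pow_left h2 r)))
    rw [← Set.ncard_coe_finset]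
    refine Set.ncard_le_ncard ?_ (Set.toFinite _)
    intro T hT
    simp only [Finset.coe_filter, Set.Finite.mem_toFinset] at hT
    exact ⟨hT.1.1, Quotient.exact hT.2⟩

/-- The lower bound on the number of graphs, with an explicit error term. -/
theorem two_pow_le_numUnlabelled [Finite A] (hB : B.index = 2) (hex : ¬ IsExceptionalPair B)
    {ρ : A → ℕ} (hρ : Function.Injective ρ) (L q : ℕ) (hn : 4 < Nat.card A)
    (hL : Nat.card A + 1 ≤ 2 ^ L)
    (hq0 : 0 < q) (hqn : q ≤ Nat.card A) (hq' : Nat.card A ≤ (q + 2) * q)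
    (hbad : 16 * (1 + L + L * (2 * q)) ≤ Nat.card A) :
    2 ^ (inverseTransversal ρ B).ncard ≤
      2 ^ (1 + L + L * ((q + 2) * (2 * L + 1)) * L) * numUnlabelledBipartiteCayleyGraphs B := by
  classical
  set n := Nat.card A with hn'
  set k := (inverseTransversal ρ B).ncard with hk
  set F := bipartiteConnectionSets B with hF
  set G := {S ∈ F | ∀ d ∈ B, d ≠ 1 → 2 * q < (symmDiff S (d • S)).ncard} with hG
  let D : A → Set (Set A) := fun d => {S ∈ F | (symmDiff S (d • S)).ncard ≤ 2 * q}
  have := Fintype.ofFinite A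
  have hFk : F.ncard = 2 ^ k := ncard_bipartiteConnectionSets hρ
  let I : Finset A := Finset.univ.filter fun d => d ∈ B ∧ d ≠ 1
  have hcover : F ⊆ G ∪ ⋃ d ∈ I, D d := by
    intro S hS
    by_cases hSG : S ∈ G
    · exact Or.inl hSG
    · right
      have : ∃ d ∈ B, d ≠ 1 ∧ (symmDiff S (d • S)).ncard ≤ 2 * q := by
        by_contra! h
        exact hSG ⟨hS, h⟩
      obtain ⟨d, hdB, hd, h⟩ := this
      simp only [Set.mem_iUnion]
      exact ⟨d, by simp [I, hdB, hd], hS, h⟩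
  have hD : ∀ d ∈ I, (D d).ncard * 2 ^ (n / 16) ≤ 2 ^ k * (n + 1) ^ (2 * q) := by
    intro d hd
    simp only [I, Finset.mem_filter, Finset.mem_univ, true_and] at hd
    exact ncard_almost_invariant_le hB hρ hd.1 hd.2
      (four_mul_ncard_sq_eq_le hB hn hex (inv_ne_one.2 hd.2)) _
  -- The saving of n/16 bits outweighs the choice of d, the at most 2q points of S ∆ dS and one
  -- further bit, so bad sets are at most half of all.
  have hsum : (∑ d ∈ I, (D d).ncard) * 2 ≤ 2 ^ k := by
    have h1 : (∑ d ∈ I, (D d).ncard) * 2 ^ (n / 16) ≤ 2 ^ L * (2 ^ k * (2 ^ L) ^ (2 * q)) := by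
      rw [Finset.sum_mul]
      refine (Finset.sum_le_card_nsmul I _ _ hD).trans ?_
      rw [smul_eq_mul]
      have hI : I.card ≤ n := by
        rw [hn', Nat.card_eq_fintype_card]
        exact Finset.card_le_univ _
      refine Nat.mul_le_mul (by omega) (Nat.mul_le_mul_left _ (Nat.pow_le_pow_left hL _))
    have h2 : 2 ^ (1 + L + L * (2 * q)) ≤ 2 ^ (n / 16) :=
      Nat.pow_le_pow_right (by norm_num) (by omega)
    refine Nat.le_of_mul_le_mul_right (c := 2 ^ (L + L * (2 * q))) ?_ (by positivity)
    calc (∑ d ∈ I, (D d).ncard) * 2 * 2 ^ (L + L * (2 * q))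
        = (∑ d ∈ I, (D d).ncard) * 2 ^ (1 + L + L * (2 * q)) := by rw [add_assoc, pow_add 2 1]; ring
      _ ≤ (∑ d ∈ I, (D d).ncard) * 2 ^ (n / 16) := Nat.mul_le_mul_left _ h2
      _ ≤ _ := h1
      _ = _ := by rw [pow_add, pow_mul]; ring
  have hFG : 2 ^ k ≤ 2 * G.ncard := by
    have h1 := Set.ncard_le_ncard hcover (Set.toFinite _)
    have h2 := Set.ncard_union_le G (⋃ d ∈ I, D d)
    have h3 : (⋃ d ∈ I, D d).ncard ≤ ∑ d ∈ I, (D d).ncard := Finset.set_ncard_biUnion_le I D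
    omega
  obtain ⟨r, g, hr, hg⟩ := exists_generating_tuple A
  have hrL : r ≤ L := by
    have : 2 ^ r ≤ 2 ^ L := by omega
    exact (Nat.pow_le_pow_iff_right (by norm_num)).1 this
  have hlt : n ^ 2 < 2 ^ (2 * L + 1) := by
    calc n ^ 2 < (2 ^ L) ^ 2 := Nat.pow_lt_pow_left (by omega) (by norm_num)
      _ = 2 ^ (2 * L) := by rw [← pow_mul, mul_comm]
      _ ≤ _ := Nat.pow_le_pow_right (by norm_num) (by omega)
  -- Since n ≤ (q + 2)q, each block of q + 2 random vertices halves the chance of missing a given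
  -- difference; 2L + 1 blocks beat the at most n² pairs of vertices.
  have hGle := ncard_good_le hB q ((q + 2) * (2 * L + 1)) r (by omega)
    (mul_sub_pow_lt (by omega) (by omega) hqn hq' hlt) g hg
  have hfac : n * (n ^ ((q + 2) * (2 * L + 1))) ^ r ≤
      2 ^ (L + L * ((q + 2) * (2 * L + 1)) * L) := by
    have hnL : n ≤ 2 ^ L := by omega
    calc n * (n ^ ((q + 2) * (2 * L + 1))) ^ r
        ≤ 2 ^ L * ((2 ^ L) ^ ((q + 2) * (2 * L + 1))) ^ L := by
          refine Nat.mul_le_mul hnL ((Nat.pow_le_pow_left (Nat.pow_le_pow_left hnL _) _).trans ?_)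
          exact Nat.pow_le_pow_right (by positivity) hrL
      _ = _ := by rw [pow_add, pow_mul 2 (L * _) L, pow_mul 2 L (_ * _)]
  calc 2 ^ k ≤ 2 * G.ncard := hFG
    _ ≤ 2 * (2 ^ (L + L * ((q + 2) * (2 * L + 1)) * L) * numUnlabelledBipartiteCayleyGraphs B) :=
        Nat.mul_le_mul_left _ (hGle.trans (Nat.mul_le_mul_right _ hfac))
    _ = _ := by rw [add_assoc, pow_add 2 1]; ring

end

/-! ### Asymptotics and conclusion. -/

/-- The exponent is O(√n log³ n), and log³ n = o(√n). The constant 896 is 2 · 7 · 4³, from ℓ ≤ 4 log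
n and the bound 7ℓ³√n. -/
theorem exists_forall_error_le (ε : ℝ) (hε : 0 < ε) : ∃ n₀ : ℕ, ∀ n : ℕ, n₀ ≤ n →
    ((1 + (Nat.log 2 n + 2) + (Nat.log 2 n + 2) * ((Nat.sqrt n + 2) *
      (2 * (Nat.log 2 n + 2) + 1)) * (Nat.log 2 n + 2) : ℕ) : ℝ) ≤ ε * n := by
  have hlo := (isLittleO_log_rpow_rpow_atTop 3 (show (0 : ℝ) < 1 / 2 by norm_num)).bound
    (show 0 < ε / 896 by positivity)
  have hlo' := tendsto_natCast_atTop_atTop (R := ℝ) |>.eventually hlo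
  obtain ⟨N, hN⟩ := Filter.eventually_atTop.1 hlo'
  refine ⟨max N 9, fun n hn => ?_⟩
  have hn9 : 9 ≤ n := (le_max_right _ _).trans hn
  have hb := hN n ((le_max_left _ _).trans hn)
  have hn9' : (9 : ℝ) ≤ n := by exact_mod_cast hn9
  have hlog2 : 1 ≤ 2 * Real.log 2 := by linarith [Real.log_two_gt_d9]
  have hlog1 : 1 ≤ Real.log n := by
    have h1 : Real.log 8 ≤ Real.log n := Real.log_le_log (by norm_num) (by linarith)
    have h2 : Real.log 8 = 3 * Real.log 2 := by
      rw [show (8 : ℝ) = 2 ^ 3 by norm_num, Real.log_pow]; norm_num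
    linarith
  set x : ℝ := Real.log n with hx
  set y : ℝ := √(n : ℝ) with hy
  have hyn : y * y = n := Real.mul_self_sqrt (by positivity)
  have hy3 : 3 ≤ y := by
    rw [hy]
    exact Real.le_sqrt_of_sq_le (by linarith)
  have hs : (Nat.sqrt n : ℝ) ≤ y := Real.nat_sqrt_le_real_sqrt
  have hL : (Nat.log 2 n : ℝ) ≤ 2 * x := by
    have h1 : (Nat.log 2 n : ℝ) ≤ Real.logb 2 n := by exact_mod_cast Real.natLog_le_logb n 2
    refine h1.trans ?_
    rw [Real.logb, div_le_iff₀ (by linarith)]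
    nlinarith
  rw [Real.norm_of_nonneg (by positivity), Real.norm_of_nonneg (by positivity),
    ← Real.sqrt_eq_rpow] at hb
  have hb' : x ^ 3 ≤ ε / 896 * y := by exact_mod_cast hb
  push_cast
  have hL2 : (Nat.log 2 n : ℝ) + 2 ≤ 4 * x := by linarith
  set ℓ : ℝ := (Nat.log 2 n : ℝ) + 2 with hℓ
  have hℓ2 : 2 ≤ ℓ := by simp [hℓ]
  have hprod : 1 + ℓ + ℓ * ((Nat.sqrt n + 2) * (2 * ℓ + 1)) * ℓ ≤ 7 * ℓ ^ 3 * y := by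
    have h1 : ((Nat.sqrt n : ℝ) + 2) * (2 * ℓ + 1) ≤ (2 * y) * (3 * ℓ) := by
      apply mul_le_mul <;> linarith
    have h2 : ℓ * ((Nat.sqrt n + 2) * (2 * ℓ + 1)) * ℓ ≤ 6 * ℓ ^ 3 * y := by
      calc _ ≤ ℓ * ((2 * y) * (3 * ℓ)) * ℓ := by gcongr
        _ = _ := by ring
    have h3 : 1 + ℓ ≤ ℓ ^ 3 * y := by
      have : ℓ * 4 ≤ ℓ ^ 3 := by nlinarith [mul_nonneg (show 0 ≤ ℓ by linarith) (show 0 ≤ ℓ ^ 2 - 4 by nlinarith)]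
      nlinarith
    linarith
  calc _ ≤ 7 * ℓ ^ 3 * y := hprod
    _ ≤ 7 * (4 * x) ^ 3 * y := by gcongr
    _ = 448 * x ^ 3 * y := by ring
    _ ≤ 448 * (ε / 896 * y) * y := by gcongr
    _ = ε / 2 * (y * y) := by ring
    _ ≤ ε * n := by rw [hyn]; nlinarith

theorem theorem1p11 (ε : ℝ) (hε : 0 < ε) :
    ∃ n₀ : ℕ, ∀ (A : Type*) [CommGroup A] [Finite A] (B : Subgroup A),
      B.index = 2 → ¬ IsExceptionalPair B → n₀ ≤ Nat.card A →
        (2 : ℝ) ^ ((Nat.card A : ℝ) / 4 + ({a : A | a ^ 2 = 1 ∧ a ∉ B}.ncard : ℝ) / 2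
            - ε * (Nat.card A : ℝ)) ≤ (numUnlabelledBipartiteCayleyGraphs B : ℝ) ∧
        (numUnlabelledBipartiteCayleyGraphs B : ℝ) ≤
          (2 : ℝ) ^ ((Nat.card A : ℝ) / 4 + ({a : A | a ^ 2 = 1 ∧ a ∉ B}.ncard : ℝ) / 2
            + ε * (Nat.card A : ℝ)) := by
  obtain ⟨N₁, hN₁⟩ := exists_forall_error_le ε hε
  -- The value 1/16 matches the n/16 bits saved on bad sets and yields the hypothesis `hbad`.
  obtain ⟨N₂, hN₂⟩ := exists_forall_error_le (1 / 16) (by norm_num)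
  refine ⟨max (max N₁ N₂) 5, fun A _ _ B hB hex hn => ?_⟩
  have hn5 : 4 < Nat.card A := (le_max_right _ _).trans hn
  have h1 := hN₁ _ ((le_max_left _ _).trans ((le_max_left _ _).trans hn))
  have h2 := hN₂ _ ((le_max_right _ _).trans ((le_max_left _ _).trans hn))
  obtain ⟨ρ, hρ⟩ : ∃ ρ : A → ℕ, Function.Injective ρ := Countable.exists_injective_nat A
  have hk := four_mul_ncard_inverseTransversal hB hρ
  have hF := ncard_bipartiteConnectionSets (B := B) hρ
  have hupper := numUnlabelled_le A hB
  rw [hF] at hupper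
  set n := Nat.card A with hn'
  set k := (inverseTransversal ρ B).ncard with hk'
  set L := Nat.log 2 n + 2 with hL
  set q := Nat.sqrt n with hq
  have hexp : (n : ℝ) / 4 + ({a : A | a ^ 2 = 1 ∧ a ∉ B}.ncard : ℝ) / 2 = k := by
    have : (4 : ℝ) * k = n + 2 * {a : A | a ^ 2 = 1 ∧ a ∉ B}.ncard := by exact_mod_cast hk
    linarith
  rw [hexp]
  constructor
  · have hnL : n < 2 ^ (Nat.log 2 n + 1) := Nat.lt_pow_succ_log_self (by norm_num) n
    have hq0 : 0 < q := Nat.sqrt_pos.2 (by omega)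
    have hLow := two_pow_le_numUnlabelled hB hex hρ L q hn5
      (by rw [hL, pow_succ]; omega) hq0 (Nat.sqrt_le_self n)
      -- n < (q + 1)² means n ≤ q² + 2q = (q + 2)q.
      (by have := Nat.lt_succ_sqrt n; rw [← hq, Nat.succ_eq_add_one] at this; nlinarith) ?_
    · rw [Real.rpow_sub (by norm_num), div_le_iff₀ (by positivity), Real.rpow_natCast]
      calc (2 : ℝ) ^ k ≤ 2 ^ (1 + L + L * ((q + 2) * (2 * L + 1)) * L) *
            (numUnlabelledBipartiteCayleyGraphs B : ℝ) := by exact_mod_cast hLow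
        _ ≤ (2 : ℝ) ^ (ε * n) * (numUnlabelledBipartiteCayleyGraphs B : ℝ) := by
            gcongr
            rw [← Real.rpow_natCast]
            exact Real.rpow_le_rpow_of_exponent_le (by norm_num) h1
        _ = _ := mul_comm _ _
    · have h3 : 16 * (1 + L + L * ((q + 2) * (2 * L + 1)) * L) ≤ n := by
        have : (16 : ℝ) * ((1 + L + L * ((q + 2) * (2 * L + 1)) * L : ℕ) : ℝ) ≤ n := by linarith
        exact_mod_cast this
      have h4 : L * (2 * q) ≤ L * ((q + 2) * (2 * L + 1)) * L := by
        have hL1 : 1 ≤ L := by omega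
        calc L * (2 * q) = L * (q * 2) * 1 := by ring
          _ ≤ L * ((q + 2) * (2 * L + 1)) * L := by gcongr <;> omega
      omega
  · calc (numUnlabelledBipartiteCayleyGraphs B : ℝ) ≤ 2 ^ k := by exact_mod_cast hupper
      _ = (2 : ℝ) ^ (k : ℝ) := (Real.rpow_natCast _ _).symm
      _ ≤ _ := Real.rpow_le_rpow_of_exponent_le (by norm_num)
          (le_add_of_nonneg_right (by positivity))
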